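/- Work over $\mathbb{C}$. Let $n\ge 0$ and $d\ge 1$, let $S^d$ be the space of forms of degree $d$ in $n+1$ variables, and let $X=\nu_d(\mathbb{P}^n)=\{[\ell^d] : 0\ne \ell\in S^1\}\subset \mathbb{P}(S^d)$ be the Veronese variety. For $f\in\mathbb{P}(S^d)$, the rank $\operatorname{rk}_X(f)$ is the least $s$ such that $f$ lies in the linear span of $s$ distinct points of $X$; the generic rank $g$ is the rank of all points of some nonempty Zariski open subset of $\mathbb{P}(S^d)$. The forbidden locus $\mathfrak{F}(f)$ is the set of points of $X$ which do not belong to any set $Z\subset X$ of $\operatorname{rk}_X(f)$ distinct points with $f\in\langle Z\rangle$. Let $m>g$ be an integer and let $W_m\subset\mathbb{P}(S^d)$ be the Zariski closure of the locus of forms of rank exactly $m$. Suppose that $W_m$ is the Zariski closure of the orbit of some $f\in\mathbb{P}(S^d)$ under the action of $\mathrm{GL}_{n+1}(\mathbb{C})$ by linear changes of variables. Then $\mathfrak{F}(f)$ is contained in a Zariski closed subset $Z\subsetneq X$. -/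

import Mathlib

open scoped LinearAlgebra.Projectivization Topology

noncomputable section

namespace XRank

/-! ### The Zariski topology on a projective space -/

section Zariski

variable {E : Type*} [AddCommGroup E] [Module ℂ E]

/-- The value at `v : E` of a polynomial `F` in linear functionals on `E`. For finite-dimensional
`E` these are the usual polynomials in the coordinates of `v`. -/
def evalAt (F : MvPolynomial (Module.Dual ℂ E) ℂ) (v : E) : ℂ :=
  MvPolynomial.eval (fun φ : Module.Dual ℂ E => φ v) F

/-- The common zero locus in `ℙ(E)` of a set of polynomials (used for sets of homogeneous ones,
for which vanishing does not depend on the representative). -/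
def zeroLocus (S : Set (MvPolynomial (Module.Dual ℂ E) ℂ)) : Set (ℙ ℂ E) :=
  {p | ∀ F ∈ S, evalAt F p.rep = 0}

/-- A subset of `ℙ(E)` is Zariski closed if it is the common zero locus of a set of homogeneous
polynomials. -/
def IsZariskiClosed (Z : Set (ℙ ℂ E)) : Prop :=
  ∃ S : Set (MvPolynomial (Module.Dual ℂ E) ℂ),
    (∀ F ∈ S, ∃ k : ℕ, F.IsHomogeneous k) ∧ Z = zeroLocus S

theorem evalAt_smul {F : MvPolynomial (Module.Dual ℂ E) ℂ} {k : ℕ} (hF : F.IsHomogeneous k)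
    (c : ℂ) (v : E) : evalAt F (c • v) = c ^ k * evalAt F v := by
  simp only [evalAt, MvPolynomial.eval_eq, map_smul, smul_eq_mul, Finset.mul_sum]
  refine Finset.sum_congr rfl fun s hs => ?_
  have hk : s.degree = k := by
    have := hF (MvPolynomial.mem_support_iff.mp hs)
    exact (DFunLike.congr_fun (Finsupp.degree_eq_weight_one (R := ℕ)) s).trans this
  rw [← hk, Finsupp.degree_apply]
  simp only [mul_pow, Finset.prod_mul_distrib, Finset.prod_pow_eq_pow_sum]
  ring

/-- Vanishing of a homogeneous polynomial at a point of `ℙ(E)` may be tested on any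
representative. -/
theorem evalAt_rep_mk {F : MvPolynomial (Module.Dual ℂ E) ℂ} {k : ℕ} (hF : F.IsHomogeneous k)
    (v : E) (hv : v ≠ 0) :
    evalAt F (Projectivization.mk ℂ v hv).rep = 0 ↔ evalAt F v = 0 := by
  obtain ⟨a, ha⟩ := Projectivization.exists_smul_eq_mk_rep ℂ v hv
  rw [← ha, Units.smul_def, evalAt_smul hF]
  simp

/-- The Zariski topology on `ℙ(E)`. -/
abbrev zariskiTopology (E : Type*) [AddCommGroup E] [Module ℂ E] : TopologicalSpace (ℙ ℂ E) :=
  TopologicalSpace.ofClosed {Z | IsZariskiClosed Z}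
    ⟨{1}, by
      rintro F rfl
      exact ⟨0, MvPolynomial.isHomogeneous_one _ _⟩, by
      ext p
      simp [zeroLocus, evalAt]⟩
    (by
      intro A hA
      refine ⟨{F | (∃ k : ℕ, F.IsHomogeneous k) ∧ ∃ Z ∈ A, ∀ p ∈ Z, evalAt F p.rep = 0},
        fun F hF => hF.1, ?_⟩
      ext p
      constructor
      · rintro hp F ⟨-, Z, hZ, h⟩
        exact h p (hp Z hZ)
      · intro hp Z hZ
        obtain ⟨S, hS, hZS⟩ := hA hZ
        rw [hZS]
        intro F hF
        exact hp F ⟨hS F hF, Z, hZ, fun q hq => (hZS ▸ hq : q ∈ zeroLocus S) F hF⟩)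
    (by
      rintro _ ⟨S, hS, rfl⟩ _ ⟨T, hT, rfl⟩
      refine ⟨{H | ∃ F ∈ S, ∃ G ∈ T, H = F * G}, ?_, ?_⟩
      · rintro _ ⟨F, hF, G, hG, rfl⟩
        obtain ⟨k, hk⟩ := hS F hF
        obtain ⟨l, hl⟩ := hT G hG
        exact ⟨k + l, hk.mul hl⟩
      · ext p
        constructor
        · rintro (hp | hp) _ ⟨F, hF, G, hG, rfl⟩
          · have := hp F hF
            simp only [evalAt] at this
            simp [evalAt, this]
          · have := hp G hG
            simp only [evalAt] at this
            simp [evalAt, this]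
        · intro hp
          by_contra hcon
          simp only [Set.mem_union, not_or, zeroLocus, Set.mem_ofPred_eq, not_forall] at hcon
          obtain ⟨⟨F, hF, hF0⟩, ⟨G, hG, hG0⟩⟩ := hcon
          have := hp _ ⟨F, hF, G, hG, rfl⟩
          simp only [evalAt, map_mul, mul_eq_zero] at this
          exact this.elim hF0 hG0)

end Zariski

/-! ### Rank with respect to a subset of a projective space -/

section Rank

variable {E : Type*} [AddCommGroup E] [Module ℂ E]

/-- The `X`-rank of `f`: the least `s` such that `f` lies in the linear span of `s` distinct points
of `X`. -/
def rank (X : Set (ℙ ℂ E)) (f : ℙ ℂ E) : ℕ :=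
  sInf {s | ∃ Z : Finset (ℙ ℂ E), (Z : Set (ℙ ℂ E)) ⊆ X ∧ Z.card = s ∧
    f ∈ Projectivization.Subspace.span (Z : Set (ℙ ℂ E))}

/-- `g` is the generic `X`-rank: all points of some nonempty Zariski open set have rank `g`. -/
def IsGenericRank (X : Set (ℙ ℂ E)) (g : ℕ) : Prop :=
  ∃ U : Set (ℙ ℂ E), IsOpen[zariskiTopology E] U ∧ U.Nonempty ∧ ∀ f ∈ U, rank X f = g

/-- `W_m`: the Zariski closure of the locus of points of `X`-rank `m`. -/
def rankLocusClosure (X : Set (ℙ ℂ E)) (m : ℕ) : Set (ℙ ℂ E) :=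
  closure[zariskiTopology E] {f | rank X f = m}

/-- The forbidden locus of `f`: the points of `X` that are not in any set `Z` of `rank X f`
points of `X` whose linear span contains `f`. (A smooth zero-dimensional subscheme of length `r`
over `ℂ` is a set of `r` distinct reduced points.) -/
def forbiddenLocus (X : Set (ℙ ℂ E)) (f : ℙ ℂ E) : Set (ℙ ℂ E) :=
  {l | l ∈ X ∧ ∀ Z : Finset (ℙ ℂ E), (Z : Set (ℙ ℂ E)) ⊆ X → Z.card = rank X f →
    f ∈ Projectivization.Subspace.span (Z : Set (ℙ ℂ E)) → l ∉ Z}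

end Rank

/-! ### Forms, the Veronese variety and the action of the general linear group -/

/-- The space of forms of degree `d` in the `n + 1` variables `x₀, …, xₙ` over `ℂ`. -/
abbrev Forms (n d : ℕ) : Type :=
  MvPolynomial.homogeneousSubmodule (Fin (n + 1)) ℂ d

/-- The `d`-th power of a linear form. -/
def powForm (n d : ℕ) (l : Forms n 1) : Forms n d :=
  ⟨(l : MvPolynomial (Fin (n + 1)) ℂ) ^ d, by
    have h : (l : MvPolynomial (Fin (n + 1)) ℂ).IsHomogeneous 1 := l.2
    simpa using h.pow d⟩

theorem powForm_ne_zero (n d : ℕ) {l : Forms n 1} (hl : l ≠ 0) : powForm n d l ≠ 0 := by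
  intro h
  have h' : (l : MvPolynomial (Fin (n + 1)) ℂ) ^ d = 0 := congrArg Subtype.val h
  exact hl (Subtype.ext (eq_zero_of_pow_eq_zero h'))

/-- The Veronese map `[l] ↦ [l ^ d]`. -/
def veroneseMap (n d : ℕ) : ℙ ℂ (Forms n 1) → ℙ ℂ (Forms n d) :=
  Projectivization.lift
    (fun l => Projectivization.mk ℂ (powForm n d l.1) (powForm_ne_zero n d l.2))
    (by
      rintro a b t hab
      rw [Projectivization.mk_eq_mk_iff']
      refine ⟨t ^ d, Subtype.ext ?_⟩
      simp [powForm, hab, smul_pow])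

/-- The `d`-th Veronese variety of `ℙⁿ`, in the projective space of forms of degree `d`. -/
def veronese (n d : ℕ) : Set (ℙ ℂ (Forms n d)) := Set.range (veroneseMap n d)

/-- The linear substitution `x_i ↦ ∑ j, g i j * x_j` on forms of degree `d`. -/
def substForm (n d : ℕ) (g : GL (Fin (n + 1)) ℂ) : Forms n d →ₗ[ℂ] Forms n d :=
  ((MvPolynomial.bind₁ (g : Matrix (Fin (n + 1)) (Fin (n + 1)) ℂ).toMvPolynomial).toLinearMap
    ).restrict (by
      intro p hp
      have hp' : p.IsHomogeneous d := hp
      have h := hp'.aeval _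
        (g : Matrix (Fin (n + 1)) (Fin (n + 1)) ℂ).toMvPolynomial_isHomogeneous
      rw [one_mul] at h
      exact h)

theorem substForm_injective (n d : ℕ) (g : GL (Fin (n + 1)) ℂ) :
    Function.Injective (substForm n d g) := by
  have key : ∀ p : MvPolynomial (Fin (n + 1)) ℂ,
      MvPolynomial.bind₁ ((g⁻¹ : GL (Fin (n + 1)) ℂ) :
          Matrix (Fin (n + 1)) (Fin (n + 1)) ℂ).toMvPolynomial
        (MvPolynomial.bind₁ (g : Matrix (Fin (n + 1)) (Fin (n + 1)) ℂ).toMvPolynomial p) = p := by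
    intro p
    rw [MvPolynomial.bind₁_bind₁]
    simp_rw [← Matrix.toMvPolynomial_mul]
    rw [← Units.val_mul, mul_inv_cancel, Units.val_one]
    simp [Matrix.toMvPolynomial_one, MvPolynomial.bind₁_X_left]
  intro p q hpq
  have h : MvPolynomial.bind₁ (g : Matrix (Fin (n + 1)) (Fin (n + 1)) ℂ).toMvPolynomial
        (p : MvPolynomial (Fin (n + 1)) ℂ) =
      MvPolynomial.bind₁ (g : Matrix (Fin (n + 1)) (Fin (n + 1)) ℂ).toMvPolynomial
        (q : MvPolynomial (Fin (n + 1)) ℂ) := congrArg Subtype.val hpq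
  apply Subtype.ext
  rw [← key p, h, key q]

/-- The orbit of `f` under the action of `GL_{n+1}(ℂ)` by linear changes of variables. -/
def glOrbit (n d : ℕ) (f : ℙ ℂ (Forms n d)) : Set (ℙ ℂ (Forms n d)) :=
  Set.range fun g : GL (Fin (n + 1)) ℂ =>
    Projectivization.map (substForm n d g) (substForm_injective n d g) f

end XRank

end

noncomputable section

namespace XRank

/-! ### Chevalley's theorem on closed points -/

section Chevalley

open MvPolynomial PrimeSpectrum

variable {σ τ : Type}

/-! Write `m = k + 1`, so `g ≤ k`, and let `v` represent `f`. By Chevalley an orbit contains a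
nonempty open subset of its closure, so it meets the rank `m` locus and `f` itself has rank `m`
(`exists_substForm_mem`). It is enough that `v + ℓ^d` has rank at most `k` for general `ℓ`: moving
`ℓ^d` to the other side gives a decomposition of `v` of minimal length through `[ℓ^d]`.

Membership in `SumPow` is decided generically (`generically_mem_sumPow_or_not`), so suppose `v +
ℓ^d` generically has rank above `k`. Rank exactly `k + 1` is impossible: `v + ℓ^d` would lie in the
cone over `W_m` for every `ℓ`, so by GL-invariance this cone would absorb all powers and be the
whole space, against `m > g` (`not_generically_mem_sdiff`). So the rank is above `k + 1`. One more
general power lowers it by at most one, and the value `k + 1` is excluded as before, so it stays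
above `k + 1` however many powers are added. But enough powers reach a general form, of rank `g ≤
k`: a contradiction (`generically_add_linPow_mem_sumPow`).

Finally `exists_isClosed_ssubset_veronese` carries genericity in `ℓ` over to the Veronese variety.
-/

theorem pointToPoint_mem_toSet_iff (C : BasicConstructibleSetData (MvPolynomial σ ℂ))
    (x : σ → ℂ) : pointToPoint (k := ℂ) x ∈ C.toSet ↔
      (∀ j, eval x (C.g j) = 0) ∧ eval x C.f ≠ 0 := by
  simp [BasicConstructibleSetData.toSet, PrimeSpectrum.mem_zeroLocus, pointToPoint,
    Set.range_subset_iff]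

/-- The prime `P` over the closed point `x` need not be maximal. By the Nullstellensatz it is the
vanishing ideal of its zeros, so some zero `y` of `P` has `C.f` nonzero; `y` still lies over `x`
because `P` contains the image of each `X i - x i`. -/
theorem mem_comap_image_iff [Finite τ] (φ : MvPolynomial σ ℂ →ₐ[ℂ] MvPolynomial τ ℂ)
    (C : BasicConstructibleSetData (MvPolynomial τ ℂ)) (x : σ → ℂ) :
    pointToPoint (k := ℂ) x ∈ PrimeSpectrum.comap φ.toRingHom '' C.toSet ↔
      ∃ y : τ → ℂ, (∀ j, eval y (C.g j) = 0) ∧ eval y C.f ≠ 0 ∧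
        ∀ i, x i = eval y (φ (X i)) := by
  have hcomp (y : τ → ℂ) (p : MvPolynomial σ ℂ) :
      eval y (φ p) = eval (fun i => eval y (φ (X i))) p := by
    have : ((aeval y).comp φ : MvPolynomial σ ℂ →ₐ[ℂ] ℂ) =
        aeval (fun i => eval y (φ (X i))) := by
      ext i
      simp
    simpa using DFunLike.congr_fun this p
  constructor
  · rintro ⟨P, hP, hPx⟩
    have hf : C.f ∉ P.asIdeal := by simpa [PrimeSpectrum.mem_zeroLocus] using hP.2
    have hg : ∀ j, C.g j ∈ P.asIdeal := fun j => hP.1 ⟨j, rfl⟩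
    have hv := IsPrime.vanishingIdeal_zeroLocus (K := ℂ) P.asIdeal
    rw [← hv, mem_vanishingIdeal_iff] at hf
    push Not at hf
    obtain ⟨y, hy, hyf⟩ := hf
    refine ⟨y, fun j => ?_, by simpa [coe_aeval_eq_eval] using hyf, fun i => ?_⟩
    · simpa [coe_aeval_eq_eval] using hy _ (hg j)
    · have hmem : X i - MvPolynomial.C (x i) ∈ (pointToPoint (k := ℂ) x).asIdeal := by
        simp [pointToPoint]
      rw [← hPx] at hmem
      have := hy _ hmem
      simp at this
      exact (sub_eq_zero.mp this).symm
  · rintro ⟨y, hg, hf, hx⟩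
    refine ⟨pointToPoint (k := ℂ) y, (pointToPoint_mem_toSet_iff C y).2 ⟨hg, hf⟩, ?_⟩
    ext p
    obtain rfl : x = fun i => eval y (φ (X i)) := funext hx
    rw [PrimeSpectrum.comap_asIdeal, Ideal.mem_comap]
    have := hcomp y p
    simp [pointToPoint, this]

/-- **Chevalley's theorem** for closed points of affine spaces over `ℂ`. -/
theorem exists_constructible_image [Finite σ] [Finite τ] (φ : MvPolynomial σ ℂ →ₐ[ℂ] MvPolynomial τ ℂ)
    (S : Finset (MvPolynomial τ ℂ)) (h : MvPolynomial τ ℂ) :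
    ∃ T : ConstructibleSetData (MvPolynomial σ ℂ), ∀ x : σ → ℂ,
      (∃ y : τ → ℂ, (∀ p ∈ S, eval y p = 0) ∧ eval y h ≠ 0 ∧ ∀ i, x i = eval y (φ (X i))) ↔
        ∃ C ∈ T, (∀ j, eval x (C.g j) = 0) ∧ eval x C.f ≠ 0 := by
  let C : BasicConstructibleSetData (MvPolynomial τ ℂ) := ⟨h, S.card, fun j => S.equivFin.symm j⟩
  have hfp : φ.toRingHom.FinitePresentation := by
    apply RingHom.FinitePresentation.of_finiteType.mp
    have : (φ.toRingHom.comp (algebraMap ℂ (MvPolynomial σ ℂ))).FiniteType := by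
      rw [AlgHom.toRingHom_eq_coe, φ.comp_algebraMap]
      exact RingHom.finiteType_algebraMap.mpr inferInstance
    exact this.of_comp_finiteType
  obtain ⟨T, hT⟩ := exists_constructibleSetData_iff.mpr
    (isConstructible_comap_image hfp
      (exists_constructibleSetData_iff.mp ⟨({C} : ConstructibleSetData _), rfl⟩))
  refine ⟨T, fun x => ?_⟩
  have hS (y : τ → ℂ) : (∀ p ∈ S, eval y p = 0) ↔ ∀ j, eval y (C.g j) = 0 := by
    constructor
    · intro H j
      exact H _ (S.equivFin.symm j).2
    · intro H p hp
      simpa [C] using H (S.equivFin ⟨p, hp⟩)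
  simp_rw [hS]
  rw [← mem_comap_image_iff φ C x]
  have : ({C} : ConstructibleSetData (MvPolynomial τ ℂ)).toSet = C.toSet := by
    simp [ConstructibleSetData.toSet]
  rw [← this, ← hT]
  simp only [ConstructibleSetData.toSet, Set.mem_iUnion, pointToPoint_mem_toSet_iff, exists_prop]

end Chevalley

/-! ### Generic points of affine spaces -/

section Generic

open MvPolynomial

variable {σ τ : Type}

/-- A property of the points of an affine space holds generically if it holds off the zero locus
of some nonzero polynomial. -/
def Generically (P : (σ → ℂ) → Prop) : Prop :=
  ∃ q : MvPolynomial σ ℂ, q ≠ 0 ∧ ∀ x, eval x q ≠ 0 → P x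

theorem exists_eval_ne_zero {q : MvPolynomial σ ℂ} (hq : q ≠ 0) : ∃ x, eval x q ≠ 0 := by
  by_contra! h
  exact hq (MvPolynomial.funext fun x => by simpa using h x)

theorem Generically.exists {P : (σ → ℂ) → Prop} (h : Generically P) : ∃ x, P x := by
  obtain ⟨q, hq, H⟩ := h
  obtain ⟨x, hx⟩ := exists_eval_ne_zero hq
  exact ⟨x, H x hx⟩

theorem Generically.and {P Q : (σ → ℂ) → Prop} (hP : Generically P) (hQ : Generically Q) :
    Generically fun x => P x ∧ Q x := by
  obtain ⟨p, hp, HP⟩ := hP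
  obtain ⟨q, hq, HQ⟩ := hQ
  refine ⟨p * q, mul_ne_zero hp hq, fun x hx => ?_⟩
  rw [map_mul] at hx
  exact ⟨HP x (left_ne_zero_of_mul hx), HQ x (right_ne_zero_of_mul hx)⟩

theorem Generically.mono {P Q : (σ → ℂ) → Prop} (hP : Generically P) (h : ∀ x, P x → Q x) :
    Generically Q := by
  obtain ⟨p, hp, HP⟩ := hP
  exact ⟨p, hp, fun x hx => h x (HP x hx)⟩

theorem Generically.comap {P : (σ → ℂ) → Prop} (hP : Generically P) {e : σ → τ}
    (he : Function.Injective e) : Generically fun x : τ → ℂ => P (x ∘ e) := by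
  obtain ⟨p, hp, HP⟩ := hP
  refine ⟨rename e p, fun h => hp (rename_injective e he (by simpa using h)), fun x hx => ?_⟩
  rw [eval_rename] at hx
  exact HP _ hx

/-- A polynomial vanishing at a generic point is zero. -/
theorem eq_zero_of_generically {q : MvPolynomial σ ℂ} (h : Generically fun x => eval x q = 0) :
    q = 0 := by
  by_contra hq
  obtain ⟨x, hx, hx'⟩ := (h.and ⟨q, hq, fun x hx => hx⟩).exists
  exact hx' hx

/-- Whether a polynomial system in `y` with parameters `x` is solvable is decided generically. -/
theorem generically_solvable_or_not [Finite σ] [Finite τ] (S : Finset (MvPolynomial (σ ⊕ τ) ℂ)) :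
    Generically (fun x : σ → ℂ => ∃ y : τ → ℂ, ∀ p ∈ S, eval (Sum.elim x y) p = 0) ∨
      Generically (fun x : σ → ℂ => ¬ ∃ y : τ → ℂ, ∀ p ∈ S, eval (Sum.elim x y) p = 0) := by
  -- Renaming along `Sum.inl` is the projection forgetting `y`; the open condition is the trivial
  -- `1`.
  obtain ⟨T, hT⟩ := exists_constructible_image (rename Sum.inl : MvPolynomial σ ℂ →ₐ[ℂ] _) S 1
  have hT' : ∀ x : σ → ℂ, (∃ y : τ → ℂ, ∀ p ∈ S, eval (Sum.elim x y) p = 0) ↔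
      ∃ C ∈ T, (∀ j, eval x (C.g j) = 0) ∧ eval x C.f ≠ 0 := by
    intro x
    rw [← hT]
    constructor
    · rintro ⟨y, hy⟩
      exact ⟨Sum.elim x y, hy, by simp, fun i => by simp⟩
    · rintro ⟨z, hz, -, hx⟩
      refine ⟨z ∘ Sum.inr, ?_⟩
      obtain rfl : x = z ∘ Sum.inl := funext fun i => by simpa using hx i
      rwa [Sum.elim_comp_inl_inr]
  simp_rw [hT']
  -- A piece with only zero equations and `C.f ≠ 0` contains a nonempty open set. If there is none,
  -- each piece misses a nonempty open set, and these finitely many open sets intersect.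
  by_cases hC : ∃ C ∈ T, (∀ j, C.g j = 0) ∧ C.f ≠ 0
  · obtain ⟨C, hC, hg, hf⟩ := hC
    exact .inl ⟨C.f, hf, fun x hx => ⟨C, hC, fun j => by simp [hg], hx⟩⟩
  · right
    push Not at hC
    have key : ∀ C ∈ T, ∃ q : MvPolynomial σ ℂ, q ≠ 0 ∧
        ∀ x, eval x q ≠ 0 → ¬ ((∀ j, eval x (C.g j) = 0) ∧ eval x C.f ≠ 0) := by
      intro C hCT
      by_cases hg : ∀ j, C.g j = 0
      · exact ⟨1, one_ne_zero, fun x _ h => h.2 (by simp [hC C hCT hg])⟩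
      · push Not at hg
        obtain ⟨j, hj⟩ := hg
        exact ⟨C.g j, hj, fun x hx h => hx (h.1 j)⟩
    choose! q hq hqx using key
    refine ⟨∏ C ∈ T, q C, Finset.prod_ne_zero_iff.mpr hq, fun x hx => ?_⟩
    rw [map_prod, Finset.prod_ne_zero_iff] at hx
    rintro ⟨C, hC, h⟩
    exact hqx C hC x (hx C hC) h

end Generic

/-! ### Sums of powers of linear forms -/

section Forms

open MvPolynomial

variable {n d : ℕ}

/-- The linear form with a given vector of coefficients. -/
def linForm (n : ℕ) (a : Fin (n + 1) → ℂ) : Forms n 1 :=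
  ⟨∑ i, a i • X i, Submodule.sum_mem _ fun i _ => Submodule.smul_mem _ _ (isHomogeneous_X ℂ i)⟩

theorem exists_eq_linForm (l : Forms n 1) : ∃ a, l = linForm n a := by
  obtain ⟨p, hp⟩ := l
  rw [homogeneousSubmodule_one_eq_span_X] at hp
  obtain ⟨a, ha⟩ := (Submodule.mem_span_range_iff_exists_fun ℂ).1 hp
  exact ⟨a, Subtype.ext ha.symm⟩

theorem linForm_injective : Function.Injective (linForm n) := by
  intro a b h
  have h' := congrArg Subtype.val h
  funext i
  have := congrArg (coeff (Finsupp.single i 1)) h'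
  simpa [linForm, coeff_sum, coeff_smul, coeff_X, Finsupp.single_left_inj] using this

/-- The `d`-th power of the linear form with a given vector of coefficients. -/
def linPow (n d : ℕ) (a : Fin (n + 1) → ℂ) : Forms n d := powForm n d (linForm n a)

theorem coe_linPow (a : Fin (n + 1) → ℂ) :
    (linPow n d a : MvPolynomial (Fin (n + 1)) ℂ) = (∑ i, a i • X i) ^ d := rfl

theorem linPow_smul (t : ℂ) (a : Fin (n + 1) → ℂ) : linPow n d (t • a) = t ^ d • linPow n d a := by
  apply Subtype.ext
  rw [Submodule.coe_smul, coe_linPow, coe_linPow, ← smul_pow, Finset.smul_sum]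
  simp [smul_smul]

theorem linPow_zero (hd : 1 ≤ d) : linPow n d 0 = 0 := by
  have := linPow_smul (d := d) 0 (0 : Fin (n + 1) → ℂ)
  rwa [zero_smul, zero_pow (by omega), zero_smul] at this

theorem linPow_ne_zero {a : Fin (n + 1) → ℂ} (ha : a ≠ 0) : linPow n d a ≠ 0 := by
  apply powForm_ne_zero
  have : linForm n 0 = 0 := Subtype.ext (by simp [linForm])
  rw [← this]
  exact fun h => ha (linForm_injective h)

/-- A `d`-th root of the coefficient is absorbed into the linear form, so linear combinations of
powers become plain sums of powers. -/
theorem exists_smul_linPow (hd : 1 ≤ d) (c : ℂ) (a : Fin (n + 1) → ℂ) :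
    ∃ t : ℂ, c • linPow n d a = linPow n d (t • a) := by
  obtain ⟨t, ht⟩ := IsAlgClosed.exists_pow_nat_eq c hd
  exact ⟨t, by rw [linPow_smul, ht]⟩

theorem exists_neg_linPow (hd : 1 ≤ d) :
    ∃ t : ℂ, t ≠ 0 ∧ ∀ a : Fin (n + 1) → ℂ, -linPow n d a = linPow n d (t • a) := by
  obtain ⟨t, ht⟩ := IsAlgClosed.exists_pow_nat_eq (-1 : ℂ) hd
  refine ⟨t, ?_, fun a => ?_⟩
  · rintro rfl
    simp [zero_pow (show d ≠ 0 by omega)] at ht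
  · rw [linPow_smul, ht]
    exact Subtype.ext (by simp)

theorem coeff_linPow (a : Fin (n + 1) → ℂ) (α : Fin (n + 1) →₀ ℕ) (hα : α.degree = d) :
    coeff α (linPow n d a : MvPolynomial (Fin (n + 1)) ℂ) = α.multinomial * ∏ i, a i ^ α i := by
  rw [coe_linPow, coeff_linearCombination_X_pow_of_fintype, if_pos]
  · rw [Finsupp.prod_fintype _ _ (by simp)]
  · rw [← hα, Finsupp.degree_apply]
    rfl

/-- The sums of `s` powers of linear forms. -/
def SumPow (n d s : ℕ) : Set (Forms n d) :=
  {v | ∃ a : Fin s → Fin (n + 1) → ℂ, v = ∑ i, linPow n d (a i)}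

theorem SumPow.add {s t : ℕ} {v w : Forms n d} (hv : v ∈ SumPow n d s) (hw : w ∈ SumPow n d t) :
    v + w ∈ SumPow n d (s + t) := by
  obtain ⟨a, rfl⟩ := hv
  obtain ⟨b, rfl⟩ := hw
  exact ⟨Fin.append a b, by simp [Fin.sum_univ_add]⟩

theorem linPow_mem_sumPow (a : Fin (n + 1) → ℂ) : linPow n d a ∈ SumPow n d 1 :=
  ⟨fun _ => a, by simp⟩

theorem sum_linPow_mem_sumPow {ι : Type*} (s : Finset ι) (a : ι → Fin (n + 1) → ℂ) :
    ∑ i ∈ s, linPow n d (a i) ∈ SumPow n d s.card := by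
  refine ⟨fun i => a (s.equivFin.symm i), ?_⟩
  rw [← Finset.sum_coe_sort]
  exact (Equiv.sum_comp s.equivFin.symm (fun i : s => linPow n d (a i))).symm

/-- Zero summands are allowed, so `SumPow n d s` encodes rank at most `s`, together with the zero
form. -/
theorem zero_mem_sumPow (hd : 1 ≤ d) (s : ℕ) : 0 ∈ SumPow n d s :=
  ⟨fun _ => 0, by simp [linPow_zero hd]⟩

theorem sumPow_mono (hd : 1 ≤ d) {s t : ℕ} (h : s ≤ t) : SumPow n d s ⊆ SumPow n d t := by
  intro v hv
  have := SumPow.add hv (zero_mem_sumPow (n := n) hd (t - s))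
  rwa [add_zero, Nat.add_sub_cancel' h] at this

theorem mem_finsuppAntidiag_iff {α : Fin (n + 1) →₀ ℕ} :
    α ∈ Finset.finsuppAntidiag Finset.univ d ↔ α.degree = d := by
  simp [Finset.mem_finsuppAntidiag, Finsupp.degree_eq_sum]

/-- Linear functionals on forms are linear combinations of the coefficients. -/
theorem dual_apply_eq_sum (ψ : Module.Dual ℂ (Forms n d)) : ∃ c : (Fin (n + 1) →₀ ℕ) → ℂ,
    ∀ v : Forms n d, ψ v = ∑ α ∈ Finset.finsuppAntidiag Finset.univ d,
      c α * coeff α (v : MvPolynomial (Fin (n + 1)) ℂ) := by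
  classical
  let e (α : Fin (n + 1) →₀ ℕ) : Forms n d :=
    if h : α.degree = d then ⟨monomial α 1, isHomogeneous_monomial 1 h⟩ else 0
  refine ⟨fun α => ψ (e α), fun v => ?_⟩
  have hv : v = ∑ α ∈ Finset.finsuppAntidiag Finset.univ d,
      coeff α (v : MvPolynomial (Fin (n + 1)) ℂ) • e α := by
    apply Subtype.ext
    rw [Submodule.coe_sum]
    conv_lhs => rw [(v : MvPolynomial (Fin (n + 1)) ℂ).as_sum]
    have hsub : (v : MvPolynomial (Fin (n + 1)) ℂ).support ⊆
        Finset.finsuppAntidiag Finset.univ d := by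
      intro α hα
      rw [mem_finsuppAntidiag_iff]
      by_contra h
      exact mem_support_iff.mp hα (IsHomogeneous.coeff_eq_zero v.2 h)
    rw [Finset.sum_subset hsub]
    · refine Finset.sum_congr rfl fun α hα => ?_
      rw [mem_finsuppAntidiag_iff] at hα
      simp [e, hα, smul_monomial]
    · intro α _ hα
      rw [notMem_support_iff.mp hα, monomial_zero]
  conv_lhs => rw [hv]
  simp [map_sum, mul_comm]

/-- The powers of linear forms span the space of forms. -/
theorem span_range_linPow : Submodule.span ℂ (Set.range (linPow n d)) = ⊤ := by
  classical
  by_contra h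
  obtain ⟨ψ, hψ, hker⟩ := Submodule.exists_le_ker_of_lt_top _ (lt_top_iff_ne_top.mpr h)
  obtain ⟨c, hc⟩ := dual_apply_eq_sum ψ
  -- The value of `ψ` on the power of a linear form, as a polynomial in its coefficient vector;
  -- multinomial coefficients are nonzero in characteristic 0.
  let p : MvPolynomial (Fin (n + 1)) ℂ :=
    ∑ α ∈ Finset.finsuppAntidiag Finset.univ d, monomial α (c α * α.multinomial)
  have hp : p = 0 := by
    refine MvPolynomial.funext fun a => ?_
    have ha : ψ (linPow n d a) = 0 := hker (Submodule.subset_span ⟨a, rfl⟩)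
    rw [hc] at ha
    rw [map_zero, ← ha, map_sum]
    refine Finset.sum_congr rfl fun α hα => ?_
    rw [coeff_linPow a α (mem_finsuppAntidiag_iff.1 hα), eval_monomial,
      Finsupp.prod_fintype _ _ (by simp)]
    ring
  apply hψ
  ext v
  rw [hc]
  refine Finset.sum_eq_zero fun α hα => ?_
  have h0 := congrArg (coeff α) hp
  simp only [p, coeff_sum, coeff_monomial, Finset.sum_ite_eq', hα, if_true, coeff_zero,
    mul_eq_zero, Nat.cast_eq_zero] at h0
  rcases h0 with h0 | h0
  · simp [h0]
  · exact absurd h0 (Nat.multinomial_pos _ _).ne'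

instance finite_forms : Module.Finite ℂ (Forms n d) :=
  Module.Finite.iff_fg.mpr (homogeneousSubmodule_fg (σ := Fin (n + 1)) (R := ℂ) d)

theorem exists_sumPow_eq_univ (hd : 1 ≤ d) : ∃ N, SumPow n d N = Set.univ := by
  obtain ⟨S, hS, hspan⟩ := (Submodule.fg_span_iff_fg_span_finset_subset (R := ℂ)
    (Set.range (linPow n d))).1 (by rw [span_range_linPow]; exact Module.Finite.fg_top)
  rw [span_range_linPow] at hspan
  refine ⟨S.card, Set.eq_univ_of_forall fun v => ?_⟩
  obtain ⟨c, -, hc⟩ := Submodule.mem_span_finset.1 (hspan ▸ Submodule.mem_top : v ∈ _)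
  have key (w : Forms n d) : ∃ a, w ∈ S → c w • w = linPow n d a := by
    by_cases hw : w ∈ S
    · obtain ⟨a, rfl⟩ := hS hw
      obtain ⟨t, ht⟩ := exists_smul_linPow hd (c (linPow n d a)) a
      exact ⟨t • a, fun _ => ht⟩
    · exact ⟨0, fun h => absurd h hw⟩
  choose a ha using key
  rw [← hc, Finset.sum_congr rfl fun w hw => ha w hw]
  exact sum_linPow_mem_sumPow S a

/-! ### Polynomial families of forms. -/

/-- A map to the space of forms is polynomial if so are the coefficients. -/
def IsPolyMap {σ : Type} (φ : (σ → ℂ) → Forms n d) : Prop :=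
  ∃ Ψ : MvPolynomial (Fin (n + 1)) (MvPolynomial σ ℂ),
    ∀ x, (φ x : MvPolynomial (Fin (n + 1)) ℂ) = map (eval x) Ψ

namespace IsPolyMap

variable {σ τ : Type}

theorem const (v : Forms n d) : IsPolyMap fun _ : σ → ℂ => v :=
  ⟨map C (v : MvPolynomial (Fin (n + 1)) ℂ), fun x => by
    rw [map_map]
    have : (eval x).comp C = RingHom.id ℂ := by ext; simp
    rw [this, map_id]⟩

theorem add {φ ψ : (σ → ℂ) → Forms n d} (hφ : IsPolyMap φ) (hψ : IsPolyMap ψ) :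
    IsPolyMap fun x => φ x + ψ x := by
  obtain ⟨Φ, hΦ⟩ := hφ
  obtain ⟨Ψ, hΨ⟩ := hψ
  exact ⟨Φ + Ψ, fun x => by simp [hΦ, hΨ]⟩

theorem sub {φ ψ : (σ → ℂ) → Forms n d} (hφ : IsPolyMap φ) (hψ : IsPolyMap ψ) :
    IsPolyMap fun x => φ x - ψ x := by
  obtain ⟨Φ, hΦ⟩ := hφ
  obtain ⟨Ψ, hΨ⟩ := hψ
  exact ⟨Φ - Ψ, fun x => by simp [hΦ, hΨ]⟩

theorem sum {ι : Type*} (s : Finset ι) {φ : ι → (σ → ℂ) → Forms n d} (hφ : ∀ i, IsPolyMap (φ i)) :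
    IsPolyMap fun x => ∑ i ∈ s, φ i x := by
  choose Φ hΦ using hφ
  exact ⟨∑ i ∈ s, Φ i, fun x => by simp [hΦ]⟩

theorem linPow (d : ℕ) (p : Fin (n + 1) → MvPolynomial σ ℂ) :
    IsPolyMap fun x : σ → ℂ => XRank.linPow n d fun i => eval x (p i) :=
  ⟨(∑ i, C (p i) * X i) ^ d, fun x => by simp [coe_linPow, smul_eq_C_mul]⟩

theorem linPow_coord (d : ℕ) (e : Fin (n + 1) → σ) :
    IsPolyMap fun x : σ → ℂ => XRank.linPow n d fun i => x (e i) := by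
  simpa using IsPolyMap.linPow d fun i => X (e i)

theorem comp {φ : (σ → ℂ) → Forms n d} (hφ : IsPolyMap φ) (e : σ → τ) :
    IsPolyMap fun x : τ → ℂ => φ (x ∘ e) := by
  obtain ⟨Φ, hΦ⟩ := hφ
  refine ⟨map (rename e).toRingHom Φ, fun x => ?_⟩
  rw [map_map, hΦ]
  congr 2
  ext <;> simp

theorem dual {φ : (σ → ℂ) → Forms n d} (hφ : IsPolyMap φ) (ψ : Module.Dual ℂ (Forms n d)) :
    ∃ q : MvPolynomial σ ℂ, ∀ x, ψ (φ x) = eval x q := by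
  obtain ⟨Φ, hΦ⟩ := hφ
  obtain ⟨c, hc⟩ := dual_apply_eq_sum ψ
  exact ⟨∑ α ∈ Finset.finsuppAntidiag Finset.univ d, C (c α) * coeff α Φ, fun x => by
    simp [hc, hΦ, coeff_map]⟩

theorem evalAt {φ : (σ → ℂ) → Forms n d} (hφ : IsPolyMap φ)
    (F : MvPolynomial (Module.Dual ℂ (Forms n d)) ℂ) :
    ∃ q : MvPolynomial σ ℂ, ∀ x, XRank.evalAt F (φ x) = eval x q := by
  choose q hq using hφ.dual
  refine ⟨bind₁ q F, fun x => ?_⟩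
  simp only [XRank.evalAt, hq]
  exact (eval₂Hom_bind₁ (RingHom.id ℂ) x q F).symm

/-- Whether the value of a polynomial map is a sum of `s` powers is decided generically. -/
theorem generically_mem_sumPow_or_not [Finite σ] {φ : (σ → ℂ) → Forms n d} (hφ : IsPolyMap φ)
    (s : ℕ) : Generically (fun x => φ x ∈ SumPow n d s) ∨
      Generically (fun x => φ x ∉ SumPow n d s) := by
  -- In parameters and unknowns jointly, being a sum of `s` powers says that the finitely many
  -- coefficients of this difference vanish.
  have h : IsPolyMap fun z : σ ⊕ (Fin s × Fin (n + 1)) → ℂ =>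
      φ (z ∘ Sum.inl) - ∑ i : Fin s, XRank.linPow n d fun j => z (Sum.inr (i, j)) :=
    (hφ.comp Sum.inl).sub (IsPolyMap.sum Finset.univ fun i => IsPolyMap.linPow_coord d _)
  obtain ⟨Ψ, hΨ⟩ := h
  classical
  have key (x : σ → ℂ) : φ x ∈ SumPow n d s ↔ ∃ y : Fin s × Fin (n + 1) → ℂ,
      ∀ p ∈ Ψ.support.image fun α => coeff α Ψ, eval (Sum.elim x y) p = 0 := by
    have hy (y : Fin s × Fin (n + 1) → ℂ) :
        (∀ p ∈ Ψ.support.image fun α => coeff α Ψ, eval (Sum.elim x y) p = 0) ↔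
          φ x = ∑ i : Fin s, XRank.linPow n d fun j => y (i, j) := by
      have := hΨ (Sum.elim x y)
      simp only [Sum.elim_comp_inl, Sum.elim_inr] at this
      rw [← sub_eq_zero, ← Submodule.coe_eq_zero, this, MvPolynomial.ext_iff]
      simp only [Finset.mem_image, forall_exists_index, and_imp, forall_apply_eq_imp_iff₂,
        coeff_map, coeff_zero]
      refine ⟨fun H α => ?_, fun H α _ => H α⟩
      by_cases hα : α ∈ Ψ.support
      · exact H α hα
      · rw [notMem_support_iff.mp hα, map_zero]
    simp_rw [hy]
    exact ⟨fun ⟨a, ha⟩ => ⟨fun p => a p.1 p.2, ha⟩, fun ⟨y, h⟩ => ⟨fun i j => y (i, j), h⟩⟩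
  simp_rw [key]
  exact generically_solvable_or_not _

end IsPolyMap

end Forms

open MvPolynomial

variable {n d : ℕ}

/-! ### The action of the general linear group -/

section Action

theorem substForm_linPow (g : GL (Fin (n + 1)) ℂ) (a : Fin (n + 1) → ℂ) :
    substForm n d g (linPow n d a) =
      linPow n d (Matrix.vecMul a (g : Matrix (Fin (n + 1)) (Fin (n + 1)) ℂ)) := by
  apply Subtype.ext
  change bind₁ _ (linPow n d a : MvPolynomial (Fin (n + 1)) ℂ) = _
  rw [coe_linPow, coe_linPow, map_pow, map_sum]
  congr 1
  simp only [map_smul, bind₁_X_right, Matrix.toMvPolynomial, Finset.smul_sum, Matrix.vecMul,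
    dotProduct, Finset.sum_smul]
  rw [Finset.sum_comm]
  refine Finset.sum_congr rfl fun j _ => Finset.sum_congr rfl fun i _ => ?_
  rw [← C_mul_X_eq_monomial, ← smul_eq_C_mul, smul_smul]

/-- The order reverses because coefficient vectors are rows multiplied on the right; powers span, so
checking on them suffices. -/
theorem substForm_mul (g h : GL (Fin (n + 1)) ℂ) (v : Forms n d) :
    substForm n d (g * h) v = substForm n d h (substForm n d g v) := by
  have : substForm n d (g * h) = substForm n d h ∘ₗ substForm n d g := by
    refine LinearMap.ext_on_range span_range_linPow fun a => ?_
    simp [substForm_linPow, Matrix.vecMul_vecMul]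
  rw [this, LinearMap.comp_apply]

theorem substForm_one (v : Forms n d) : substForm n d 1 v = v := by
  have : substForm n d 1 = LinearMap.id := by
    refine LinearMap.ext_on_range span_range_linPow fun a => ?_
    simp [substForm_linPow]
  rw [this, LinearMap.id_apply]

/-- The scalar matrix of a `d`-th root of `t` acts as `t`, so the orbit of a nonzero form is the
punctured cone over its projective orbit. -/
theorem exists_smul_substForm (hd : 1 ≤ d) {t : ℂ} (ht : t ≠ 0) (g : GL (Fin (n + 1)) ℂ)
    (v : Forms n d) : ∃ h, t • substForm n d g v = substForm n d h v := by
  obtain ⟨c, hc⟩ := IsAlgClosed.exists_pow_nat_eq t hd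
  have hc0 : c ≠ 0 := by
    rintro rfl
    exact ht (by rw [← hc, zero_pow (by omega)])
  let u : GL (Fin (n + 1)) ℂ := Units.mk0 c hc0 • g
  have hu : (u : Matrix (Fin (n + 1)) (Fin (n + 1)) ℂ) = c • g.val := rfl
  refine ⟨u, ?_⟩
  have : t • substForm n d g = substForm n d u := by
    refine LinearMap.ext_on_range span_range_linPow fun a => ?_
    rw [LinearMap.smul_apply, substForm_linPow, substForm_linPow, hu, Matrix.vecMul_smul,
      linPow_smul, hc]
  rw [← this, LinearMap.smul_apply]

theorem substForm_mem_sumPow_iff {s : ℕ} (g : GL (Fin (n + 1)) ℂ) {v : Forms n d} :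
    substForm n d g v ∈ SumPow n d s ↔ v ∈ SumPow n d s := by
  have key (g : GL (Fin (n + 1)) ℂ) {v : Forms n d} (hv : v ∈ SumPow n d s) :
      substForm n d g v ∈ SumPow n d s := by
    obtain ⟨a, rfl⟩ := hv
    exact ⟨_, by rw [map_sum]; simp_rw [substForm_linPow]; rfl⟩
  refine ⟨fun h => ?_, key g⟩
  have := key g⁻¹ h
  rwa [← substForm_mul, mul_inv_cancel, substForm_one] at this

/-- The polynomial function `F` vanishes on the orbit of the form `v`. -/
def VanishesOnOrbit (v : Forms n d) (F : MvPolynomial (Module.Dual ℂ (Forms n d)) ℂ) : Prop :=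
  ∀ g, evalAt F (substForm n d g v) = 0

theorem evalAt_rename_comp (F : MvPolynomial (Module.Dual ℂ (Forms n d)) ℂ)
    (L : Forms n d →ₗ[ℂ] Forms n d) (v : Forms n d) :
    evalAt (rename (fun ψ : Module.Dual ℂ (Forms n d) => ψ ∘ₗ L) F) v = evalAt F (L v) := by
  rw [evalAt, evalAt, eval_rename]
  rfl

theorem evalAt_bind₁_translate (F : MvPolynomial (Module.Dual ℂ (Forms n d)) ℂ)
    (w v : Forms n d) :
    evalAt (bind₁ (fun ψ : Module.Dual ℂ (Forms n d) => X ψ + C (ψ w)) F) v =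
      evalAt F (v + w) := by
  have := eval₂Hom_bind₁ (RingHom.id ℂ) (fun ψ : Module.Dual ℂ (Forms n d) => ψ v)
    (fun ψ : Module.Dual ℂ (Forms n d) => X ψ + C (ψ w)) F
  refine this.trans (congrArg (fun h => eval h F) (funext fun ψ => ?_))
  simp

/-- An orbit is the image of a principal open subset of an affine space. -/
theorem exists_orbit_parametrization (hd : 1 ≤ d) (v : Forms n d) :
    ∃ φ : (Fin (n + 1) × Fin (n + 1) → ℂ) → Forms n d, IsPolyMap φ ∧
      ∃ h : MvPolynomial (Fin (n + 1) × Fin (n + 1)) ℂ, h ≠ 0 ∧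
        (∀ g, ∃ M, eval M h ≠ 0 ∧ φ M = substForm n d g v) ∧
        ∀ M, eval M h ≠ 0 → ∃ g, φ M = substForm n d g v := by
  obtain ⟨N, hN⟩ := exists_sumPow_eq_univ (n := n) hd
  obtain ⟨a, ha⟩ := (hN ▸ Set.mem_univ v : v ∈ SumPow n d N)
  -- Fixing a decomposition of `v` into powers extends the orbit map to all matrices, singular ones
  -- included.
  let φ (M : Fin (n + 1) × Fin (n + 1) → ℂ) : Forms n d :=
    ∑ i, linPow n d (Matrix.vecMul (a i) (Matrix.of fun j k => M (j, k)))
  have hφ : IsPolyMap φ := by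
    refine IsPolyMap.sum _ fun i => ?_
    have e (M : Fin (n + 1) × Fin (n + 1) → ℂ) :
        Matrix.vecMul (a i) (Matrix.of fun j k => M (j, k)) =
          fun k => eval M (∑ j, C (a i j) * X (j, k)) := by
      ext k
      simp [Matrix.vecMul, dotProduct]
    simp_rw [e]
    exact IsPolyMap.linPow d _
  have hφg (g : GL (Fin (n + 1)) ℂ) : φ (fun p => g.val p.1 p.2) = substForm n d g v := by
    rw [ha, map_sum]
    simp_rw [substForm_linPow]
    rfl
  have hh (M : Fin (n + 1) × Fin (n + 1) → ℂ) :
      eval M (Matrix.mvPolynomialX (Fin (n + 1)) (Fin (n + 1)) ℂ).det =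
        (Matrix.of fun j k => M (j, k)).det := by
    have := Matrix.mvPolynomialX_mapMatrix_eval (Matrix.of fun j k => M (j, k))
    conv_rhs => rw [← this, ← RingHom.map_det]
    rfl
  refine ⟨φ, hφ, _, Matrix.det_mvPolynomialX_ne_zero _ _, fun g =>
    ⟨fun p => g.val p.1 p.2, ?_, hφg g⟩, fun M hM => ?_⟩
  · rw [hh]
    exact (Matrix.isUnit_iff_isUnit_det _).1 g.isUnit |>.ne_zero
  · rw [hh] at hM
    refine ⟨Matrix.GeneralLinearGroup.mkOfDetNeZero _ hM, ?_⟩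
    rw [← hφg]
    rfl

/-- An orbit contains a nonempty open subset of its closure, so it meets every subset with the
same closure. -/
theorem exists_substForm_mem (hd : 1 ≤ d) {v : Forms n d} {A : Set (Forms n d)}
    (hA : ∀ F, VanishesOnOrbit v F ↔ ∀ w ∈ A, evalAt F w = 0) :
    ∃ g, substForm n d g v ∈ A := by
  classical
  obtain ⟨φ, hφ, h, hh0, hφg, hφM⟩ := exists_orbit_parametrization hd v
  let b := Module.finBasis ℂ (Forms n d)
  choose Q hQ using fun i => hφ.dual (b.coord i)
  let lift : MvPolynomial (Fin (Module.finrank ℂ (Forms n d))) ℂ →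
    MvPolynomial (Module.Dual ℂ (Forms n d)) ℂ := fun p => rename b.coord p
  have hlift (p) (w : Forms n d) : evalAt (lift p) w = eval (fun i => b.coord i w) p := by
    rw [evalAt, eval_rename]
    rfl
  obtain ⟨T, hT⟩ := exists_constructible_image (aeval Q) ∅ h
  have hT' (w : Forms n d) : (∃ g, w = substForm n d g v) ↔
      ∃ C ∈ T, (∀ j, evalAt (lift (C.g j)) w = 0) ∧ evalAt (lift C.f) w ≠ 0 := by
    simp_rw [hlift]
    rw [← hT]
    simp only [aeval_X, ← hQ]
    constructor
    · rintro ⟨g, rfl⟩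
      obtain ⟨M, hM, hMg⟩ := hφg g
      exact ⟨M, by simp, hM, fun i => by rw [hMg]⟩
    · rintro ⟨M, -, hM, hw⟩
      obtain ⟨g, hg⟩ := hφM M hM
      exact ⟨g, by rw [← hg]; exact b.ext_elem fun i => hw i⟩
  -- Such a piece is open in the orbit closure. Its equations vanish on `A` while `C.f` does not, so
  -- it contains a point of `A`.
  by_cases hC : ∃ C ∈ T, (∀ j, VanishesOnOrbit v (lift (C.g j))) ∧ ¬ VanishesOnOrbit v (lift C.f)
  · obtain ⟨C, hC, hg, hf⟩ := hC
    rw [hA] at hf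
    push Not at hf
    obtain ⟨w, hw, hwf⟩ := hf
    obtain ⟨g, rfl⟩ := (hT' w).2 ⟨C, hC, fun j => (hA _).1 (hg j) w hw, hwf⟩
    exact ⟨g, hw⟩
  -- Otherwise each piece is avoided by a general matrix, and a matrix avoiding all of them gives an
  -- orbit point in no piece.
  · exfalso
    push Not at hC
    have key : ∀ C ∈ T, ∃ q : MvPolynomial (Fin (n + 1) × Fin (n + 1)) ℂ, q ≠ 0 ∧
        ∀ M, eval M q ≠ 0 → eval M h ≠ 0 →
          ¬ ((∀ j, evalAt (lift (C.g j)) (φ M) = 0) ∧ evalAt (lift C.f) (φ M) ≠ 0) := by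
      intro C hCT
      by_cases hg : ∀ j, VanishesOnOrbit v (lift (C.g j))
      · refine ⟨1, one_ne_zero, fun M _ hM H => H.2 ?_⟩
        obtain ⟨g, hg'⟩ := hφM M hM
        rw [hg']
        exact hC C hCT hg g
      · push Not at hg
        obtain ⟨j, hj⟩ := hg
        obtain ⟨q, hq⟩ := hφ.evalAt (lift (C.g j))
        refine ⟨q, ?_, fun M hM _ H => hM (by rw [← hq, H.1 j])⟩
        rintro rfl
        refine hj fun g => ?_
        obtain ⟨M, -, hMg⟩ := hφg g
        rw [← hMg, hq, map_zero]
    choose! q hq hqx using key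
    obtain ⟨M, hM⟩ := exists_eval_ne_zero
      (mul_ne_zero hh0 (Finset.prod_ne_zero_iff.mpr hq))
    rw [map_mul, map_prod] at hM
    have hM1 := left_ne_zero_of_mul hM
    have hM2 := Finset.prod_ne_zero_iff.mp (right_ne_zero_of_mul hM)
    obtain ⟨C, hC, H⟩ := (hT' (φ M)).1 (hφM M hM1)
    exact hqx C hC M (hM2 C hC) hM1 H

end Action

/-! ### Adding a general power to a form with dense orbit -/

section Join

variable {k : ℕ} {v : Forms n d}

/-- If the orbit of `v` is dense in the locus of forms of rank `k + 1`, and a general form of this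
locus is obtained by adding powers to `v`, then that locus is dense. -/
theorem not_generically_mem_sdiff (hd : 1 ≤ d)
    (hI : ∀ F, VanishesOnOrbit v F ↔ ∀ w ∈ SumPow n d (k + 1) \ SumPow n d k, evalAt F w = 0)
    {F₀ : MvPolynomial (Module.Dual ℂ (Forms n d)) ℂ} {w₀ : Forms n d} (hw₀ : evalAt F₀ w₀ ≠ 0)
    (hF₀ : ∀ w, evalAt F₀ w ≠ 0 → w ∈ SumPow n d k)
    {σ : Type} {φ : (σ → ℂ) → Forms n d} (hφ : IsPolyMap φ)
    (hsurj : ∀ a, ∃ x, φ x = v + linPow n d a) :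
    ¬ Generically fun x => φ x ∈ SumPow n d (k + 1) \ SumPow n d k := by
  intro hgen
  have h1 {F} (hF : VanishesOnOrbit v F) (a : Fin (n + 1) → ℂ) :
      evalAt F (v + linPow n d a) = 0 := by
    obtain ⟨q, hq⟩ := hφ.evalAt F
    have : q = 0 := eq_zero_of_generically (hgen.mono fun x hx => by
      rw [← hq]; exact (hI F).1 hF _ hx)
    obtain ⟨x, hx⟩ := hsurj a
    rw [← hx, hq, this, map_zero]
  -- The equations of the orbit are GL-stable, so `v` may be replaced by any point of its orbit.
  have h2 {F} (hF : VanishesOnOrbit v F) (a : Fin (n + 1) → ℂ) (g) :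
      evalAt F (substForm n d g v + linPow n d a) = 0 := by
    have hFg : VanishesOnOrbit v
        (rename (fun ψ : Module.Dual ℂ (Forms n d) => ψ ∘ₗ substForm n d g) F) := by
      intro g'
      rw [evalAt_rename_comp, ← substForm_mul]
      exact hF _
    have := h1 hFg (Matrix.vecMul a (g⁻¹ : GL (Fin (n + 1)) ℂ).val)
    rwa [← substForm_linPow, evalAt_rename_comp, map_add, ← substForm_mul, inv_mul_cancel,
      substForm_one] at this
  have h3 (s : ℕ) : ∀ w ∈ SumPow n d s, ∀ F, VanishesOnOrbit v F →
      ∀ g, evalAt F (substForm n d g v + w) = 0 := by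
    induction s with
    | zero =>
      rintro _ ⟨a, rfl⟩ F hF g
      simpa using hF g
    | succ s ih =>
      rintro _ ⟨a, rfl⟩ F hF g
      rw [Fin.sum_univ_succ, add_comm (linPow n d (a 0)), ← add_assoc,
        -- By `h2` the translate of `F` by one power again vanishes on the orbit, so the induction
        -- applies to it.
        ← evalAt_bind₁_translate]
      refine ih _ ⟨_, rfl⟩ _ (fun g' => ?_) g
      rw [evalAt_bind₁_translate]
      exact h2 hF _ _
  obtain ⟨N, hN⟩ := exists_sumPow_eq_univ (n := n) hd
  have hF₀v : VanishesOnOrbit v F₀ := (hI F₀).2 fun w hw => by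
    by_contra h
    exact hw.2 (hF₀ w h)
  have := h3 N (w₀ - v) (hN ▸ Set.mem_univ _) F₀ hF₀v 1
  rw [substForm_one, add_sub_cancel] at this
  exact hw₀ this

/-- If the orbit of `v` is dense in the locus of forms of rank `k + 1`, which exceeds the generic
rank, then adding a general power to `v` drops the rank. -/
theorem generically_add_linPow_mem_sumPow (hd : 1 ≤ d)
    (hI : ∀ F, VanishesOnOrbit v F ↔ ∀ w ∈ SumPow n d (k + 1) \ SumPow n d k, evalAt F w = 0)
    {F₀ : MvPolynomial (Module.Dual ℂ (Forms n d)) ℂ} {w₀ : Forms n d} (hw₀ : evalAt F₀ w₀ ≠ 0)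
    (hF₀ : ∀ w, evalAt F₀ w ≠ 0 → w ∈ SumPow n d k) :
    Generically fun a => v + linPow n d a ∈ SumPow n d k := by
  classical
  have hpoly1 : IsPolyMap fun a : Fin (n + 1) → ℂ => v + linPow n d a :=
    (IsPolyMap.const v).add (IsPolyMap.linPow_coord d id)
  refine (hpoly1.generically_mem_sumPow_or_not k).resolve_right fun hnot => ?_
  obtain ⟨N, hN⟩ := exists_sumPow_eq_univ (n := n) hd
  -- Block `0` is always present, so at least one power is added; hence `N + 1` blocks.
  let φ (s : Finset (Fin (N + 1))) (x : Fin (N + 1) × Fin (n + 1) → ℂ) : Forms n d :=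
    v + ∑ i ∈ insert 0 s, linPow n d fun j => x (i, j)
  have hφ (s) : IsPolyMap (φ s) :=
    (IsPolyMap.const v).add (IsPolyMap.sum _ fun i => IsPolyMap.linPow_coord d _)
  have hsurj (s) (a : Fin (n + 1) → ℂ) : ∃ x, φ s x = v + linPow n d a := by
    refine ⟨fun p => if p.1 = 0 then a p.2 else 0, ?_⟩
    simp only [φ]
    congr 1
    rw [Finset.sum_eq_single 0]
    · simp
    · intro i _ hi
      simp only [hi, if_false]
      exact linPow_zero hd
    · simp
  have hkey (s) : ¬ Generically fun x => φ s x ∈ SumPow n d (k + 1) \ SumPow n d k :=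
    not_generically_mem_sdiff hd hI hw₀ hF₀ (hφ s) (hsurj s)
  have hall (s) : Generically fun x => φ s x ∉ SumPow n d (k + 1) := by
    induction s using Finset.induction_on with
    | empty =>
      refine ((hφ ∅).generically_mem_sumPow_or_not (k + 1)).resolve_left fun h => hkey ∅ ?_
      have := hnot.comap (e := fun j => ((0 : Fin (N + 1)), j)) fun i j hij => by simpa using hij
      refine (h.and this).mono fun x hx => ⟨hx.1, ?_⟩
      simpa [φ, Function.comp_def] using hx.2
    | insert i s _ ih =>
      by_cases hi : i ∈ insert 0 s
      · have : insert 0 (insert i s) = insert 0 s := by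
          rw [Finset.insert_comm, Finset.insert_eq_of_mem hi]
        simpa [φ, this] using ih
      refine ((hφ _).generically_mem_sumPow_or_not (k + 1)).resolve_left fun h =>
        hkey (insert i s) ?_
      -- If the new sum were in `SumPow n d k`, subtracting its last power would put the previous
      -- one in `SumPow n d (k + 1)`.
      refine ((h.and ih).mono fun x hx => ⟨hx.1, fun hmem => hx.2 ?_⟩)
      obtain ⟨t, -, ht⟩ := exists_neg_linPow (n := n) hd
      have := SumPow.add hmem (linPow_mem_sumPow (t • fun j => x (i, j)))
      have e : φ (insert i s) x + -linPow n d (fun j => x (i, j)) = φ s x := by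
        simp only [φ]
        rw [Finset.insert_comm, Finset.sum_insert hi]
        abel
      rwa [← ht, e] at this
  -- With all blocks the family reaches `w₀`, so its general member has `F₀` nonzero.
  obtain ⟨q, hq⟩ := (hφ Finset.univ).evalAt F₀
  have hq0 : q ≠ 0 := by
    rintro rfl
    obtain ⟨a, ha⟩ := (sumPow_mono hd N.le_succ (hN ▸ Set.mem_univ (w₀ - v)) :
      w₀ - v ∈ SumPow n d (N + 1))
    apply hw₀
    have := hq fun p => a p.1 p.2
    rwa [map_zero, show φ Finset.univ (fun p => a p.1 p.2) = w₀ by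
      simp [φ, ← ha]] at this
  obtain ⟨x, hx, hx'⟩ := ((hall Finset.univ).and ⟨q, hq0, fun x hx => hx⟩).exists
  rw [← hq] at hx'
  exact hx (sumPow_mono hd k.le_succ (hF₀ _ hx'))

end Join

/-! ### Ranks with respect to the Veronese variety -/

section Veronese

theorem mk_linPow_mem_veronese {a : Fin (n + 1) → ℂ} (ha : linPow n d a ≠ 0)
    (ha0 : linForm n a ≠ 0) : Projectivization.mk ℂ (linPow n d a) ha ∈ veronese n d :=
  ⟨Projectivization.mk ℂ (linForm n a) ha0, rfl⟩

theorem linForm_ne_zero {a : Fin (n + 1) → ℂ} (ha : a ≠ 0) : linForm n a ≠ 0 := by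
  have : linForm n 0 = 0 := Subtype.ext (by simp [linForm])
  rw [← this]
  exact fun h => ha (linForm_injective h)

theorem mem_veronese_iff {p : ℙ ℂ (Forms n d)} : p ∈ veronese n d ↔
    ∃ (a : Fin (n + 1) → ℂ) (ha : a ≠ 0), p = Projectivization.mk ℂ _ (linPow_ne_zero ha) := by
  constructor
  · rintro ⟨q, rfl⟩
    induction q using Projectivization.ind with
    | h l hl =>
      obtain ⟨a, rfl⟩ := exists_eq_linForm l
      have ha : a ≠ 0 := by
        rintro rfl
        exact hl (Subtype.ext (by simp [linForm]))
      exact ⟨a, ha, rfl⟩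
  · rintro ⟨a, ha, rfl⟩
    exact mk_linPow_mem_veronese _ (linForm_ne_zero ha)

theorem mk_mem_span_iff {E : Type*} [AddCommGroup E] [Module ℂ E] {Z : Set (ℙ ℂ E)} {v : E}
    (hv : v ≠ 0) : Projectivization.mk ℂ v hv ∈ Projectivization.Subspace.span Z ↔
      v ∈ Submodule.span ℂ (Projectivization.rep '' Z) := by
  constructor
  · intro h
    have hle : Projectivization.Subspace.span Z ≤
        (Submodule.span ℂ (Projectivization.rep '' Z)).projectivization := by
      rw [Projectivization.Subspace.span_le_subspace_iff]
      intro p hp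
      have : p.rep ∈ Submodule.span ℂ (Projectivization.rep '' Z) :=
        Submodule.subset_span ⟨p, hp, rfl⟩
      rw [← Submodule.mk_mem_projectivization_iff _ p.rep_nonzero, p.mk_rep] at this
      exact this
    exact (Submodule.mk_mem_projectivization_iff _ hv).1 (hle h)
  · intro h
    rw [← Projectivization.Subspace.mem_submodule_iff]
    refine Submodule.span_le.2 ?_ h
    rintro _ ⟨p, hp, rfl⟩
    rw [SetLike.mem_coe, Projectivization.Subspace.mem_submodule_iff _ p.rep_nonzero, p.mk_rep]
    exact Projectivization.Subspace.subset_span Z hp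

theorem mem_sumPow_of_mem_span (hd : 1 ≤ d) {Z : Finset (ℙ ℂ (Forms n d))}
    (hZ : (Z : Set (ℙ ℂ (Forms n d))) ⊆ veronese n d) {v : Forms n d} (hv : v ≠ 0)
    (h : Projectivization.mk ℂ v hv ∈
      Projectivization.Subspace.span (Z : Set (ℙ ℂ (Forms n d)))) :
    v ∈ SumPow n d Z.card := by
  rw [mk_mem_span_iff, Submodule.mem_span_image_finset_iff_exists_fun'] at h
  obtain ⟨c, rfl⟩ := h
  have key (z : ℙ ℂ (Forms n d)) : ∃ a, z ∈ Z → c z • z.rep = linPow n d a := by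
    by_cases hz : z ∈ Z
    · obtain ⟨a, ha, rfl⟩ := mem_veronese_iff.1 (hZ hz)
      obtain ⟨u, hu⟩ := Projectivization.exists_smul_eq_mk_rep ℂ _ (linPow_ne_zero (d := d) ha)
      rw [← hu, Units.smul_def, smul_smul]
      obtain ⟨t, ht⟩ := exists_smul_linPow hd (c (Projectivization.mk ℂ _ (linPow_ne_zero ha)) * u) a
      exact ⟨_, fun _ => ht⟩
    · exact ⟨0, fun h => absurd h hz⟩
  choose a ha using key
  rw [Finset.sum_congr rfl fun z hz => ha z hz]
  exact sum_linPow_mem_sumPow Z a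

/-- The points of the Veronese variety appearing in a sum of powers of linear forms. -/
theorem exists_finset_of_eq_sum (hd : 1 ≤ d) {s : ℕ} (a : Fin s → Fin (n + 1) → ℂ)
    {v : Forms n d} (hv : v ≠ 0) (h : v = ∑ i, linPow n d (a i)) :
    ∃ Z : Finset (ℙ ℂ (Forms n d)), (Z : Set (ℙ ℂ (Forms n d))) ⊆ veronese n d ∧ Z.card ≤ s ∧
      Projectivization.mk ℂ v hv ∈ Projectivization.Subspace.span (Z : Set (ℙ ℂ (Forms n d))) ∧
      ∀ i (hi : a i ≠ 0), Projectivization.mk ℂ _ (linPow_ne_zero (d := d) hi) ∈ Z := by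
  classical
  let I := {i : Fin s // a i ≠ 0}
  let P (i : I) : ℙ ℂ (Forms n d) := Projectivization.mk ℂ _ (linPow_ne_zero (d := d) i.2)
  have hP (i) (hi : a i ≠ 0) : Projectivization.mk ℂ _ (linPow_ne_zero (d := d) hi) ∈
      Finset.univ.image P := Finset.mem_image.2 ⟨⟨i, hi⟩, Finset.mem_univ _, rfl⟩
  -- Zero vectors give no point and proportional ones may coincide, hence only `Z.card ≤ s`.
  refine ⟨Finset.univ.image P, ?_, ?_, ?_, hP⟩
  · intro p hp
    obtain ⟨i, -, rfl⟩ := Finset.mem_image.1 (Finset.mem_coe.1 hp)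
    exact mem_veronese_iff.2 ⟨a i.1, i.2, rfl⟩
  · refine Finset.card_image_le.trans ?_
    rw [Finset.card_univ]
    exact (Fintype.card_subtype_le _).trans (Fintype.card_fin s).le
  · rw [mk_mem_span_iff, h]
    refine Submodule.sum_mem _ fun i _ => ?_
    by_cases hi : a i = 0
    · rw [hi, linPow_zero hd]
      exact Submodule.zero_mem _
    · obtain ⟨u, hu⟩ := Projectivization.exists_smul_eq_mk_rep ℂ _ (linPow_ne_zero (d := d) hi)
      rw [← inv_smul_smul u (linPow n d (a i)), hu, Units.smul_def]
      exact Submodule.smul_mem _ _ (Submodule.subset_span ⟨_, hP i hi, rfl⟩)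

theorem rank_veronese_le_iff (hd : 1 ≤ d) {s : ℕ} {v : Forms n d} (hv : v ≠ 0) :
    rank (veronese n d) (Projectivization.mk ℂ v hv) ≤ s ↔ v ∈ SumPow n d s := by
  constructor
  · intro h
    -- Some decomposition must exist, as `sInf` of the empty set would be 0.
    obtain ⟨N, hN⟩ := exists_sumPow_eq_univ (n := n) hd
    obtain ⟨a, ha⟩ := (hN ▸ Set.mem_univ v : v ∈ SumPow n d N)
    obtain ⟨Z, hZ, -, hv', -⟩ := exists_finset_of_eq_sum hd a hv ha
    obtain ⟨Z', hZ', hcard, hv''⟩ := Nat.sInf_mem (s := {s | ∃ Z : Finset (ℙ ℂ (Forms n d)),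
      (Z : Set (ℙ ℂ (Forms n d))) ⊆ veronese n d ∧ Z.card = s ∧ Projectivization.mk ℂ v hv ∈
        Projectivization.Subspace.span (Z : Set (ℙ ℂ (Forms n d)))}) ⟨_, Z, hZ, rfl, hv'⟩
    refine sumPow_mono hd ?_ (mem_sumPow_of_mem_span hd hZ' hv hv'')
    rw [hcard]
    exact h
  · rintro ⟨a, ha⟩
    obtain ⟨Z, hZ, hcard, hv', -⟩ := exists_finset_of_eq_sum hd a hv ha
    have : rank (veronese n d) (Projectivization.mk ℂ v hv) ≤ Z.card :=
      Nat.sInf_le ⟨Z, hZ, rfl, hv'⟩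
    exact this.trans hcard

theorem rank_veronese_eq_succ_iff (hd : 1 ≤ d) {k : ℕ} {v : Forms n d} (hv : v ≠ 0) :
    rank (veronese n d) (Projectivization.mk ℂ v hv) = k + 1 ↔
      v ∈ SumPow n d (k + 1) \ SumPow n d k := by
  rw [Set.mem_sdiff, ← rank_veronese_le_iff hd hv, ← rank_veronese_le_iff hd hv]
  omega

/-- If adding the power of a linear form to `v` drops the rank, then the corresponding point of
the Veronese variety is not in the forbidden locus. -/
theorem notMem_forbiddenLocus (hd : 1 ≤ d) {k : ℕ} {v : Forms n d} (hv : v ≠ 0)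
    (hrank : rank (veronese n d) (Projectivization.mk ℂ v hv) = k + 1) {a : Fin (n + 1) → ℂ}
    (ha : a ≠ 0) (h : v + linPow n d a ∈ SumPow n d k) :
    Projectivization.mk ℂ _ (linPow_ne_zero (d := d) ha) ∉
      forbiddenLocus (veronese n d) (Projectivization.mk ℂ v hv) := by
  rintro ⟨-, H⟩
  obtain ⟨b, hb⟩ := h
  obtain ⟨t, ht0, ht⟩ := exists_neg_linPow (n := n) hd
  have hta : t • a ≠ 0 := smul_ne_zero ht0 ha
  have hsum : v = ∑ i, linPow n d (Fin.cons (α := fun _ => Fin (n + 1) → ℂ) (t • a) b i) := by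
    rw [Fin.sum_univ_succ]
    simp only [Fin.cons_zero, Fin.cons_succ]
    rw [← hb, ← ht]
    abel
  obtain ⟨Z, hZ, hcard, hvZ, hmem⟩ := exists_finset_of_eq_sum hd _ hv hsum
  -- Minimality of the rank forces the `k + 1` points to be distinct.
  have hcard' : Z.card = rank (veronese n d) (Projectivization.mk ℂ v hv) :=
    le_antisymm (hcard.trans hrank.ge) (Nat.sInf_le ⟨Z, hZ, rfl, hvZ⟩)
  refine H Z hZ hcard' hvZ ?_
  have h0 := hmem 0 hta
  have : Projectivization.mk ℂ _ (linPow_ne_zero (d := d) hta) =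
      Projectivization.mk ℂ _ (linPow_ne_zero (d := d) ha) := by
    rw [Projectivization.mk_eq_mk_iff']
    exact ⟨t ^ d, (linPow_smul t a).symm⟩
  rw [← this]
  exact h0

end Veronese

/-! ### Zariski closures and cones -/

section Cone

variable {E : Type*} [AddCommGroup E] [Module ℂ E]

theorem isClosed_zariski_iff {Z : Set (ℙ ℂ E)} :
    IsClosed[zariskiTopology E] Z ↔ IsZariskiClosed Z := by
  rw [← @isOpen_compl_iff _ _ (zariskiTopology E)]
  change Zᶜᶜ ∈ {Z | IsZariskiClosed Z} ↔ _
  rw [compl_compl, Set.mem_ofPred_eq]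

theorem evalAt_rep_eq_zero_of_mem_closure {A : Set (ℙ ℂ E)} {p : ℙ ℂ E}
    (hp : p ∈ closure[zariskiTopology E] A) {F : MvPolynomial (Module.Dual ℂ E) ℂ} {k : ℕ}
    (hF : F.IsHomogeneous k) (h : ∀ q ∈ A, evalAt F q.rep = 0) : evalAt F p.rep = 0 := by
  let _ := zariskiTopology E
  have hcl : IsClosed (zeroLocus {F}) :=
    isClosed_zariski_iff.2 ⟨{F}, by rintro _ rfl; exact ⟨k, hF⟩, rfl⟩
  exact closure_minimal (fun q hq => by rintro _ rfl; exact h q hq) hcl hp F rfl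

theorem eq_zero_of_sum_pow_mul_eq_zero {N : ℕ} {c : ℕ → ℂ}
    (h : ∀ t : ℂ, t ≠ 0 → ∑ k ∈ Finset.range N, t ^ k * c k = 0) : ∀ k < N, c k = 0 := by
  let p : Polynomial ℂ := ∑ k ∈ Finset.range N, Polynomial.monomial k (c k)
  have hp (t : ℂ) : p.eval t = ∑ k ∈ Finset.range N, t ^ k * c k := by
    simp [p, Polynomial.eval_finsetSum, mul_comm]
  -- The factor `X` covers the excluded value `t = 0`.
  have hXp : Polynomial.X * p = 0 := by
    refine Polynomial.funext fun t => ?_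
    by_cases ht : t = 0
    · simp [ht]
    · simp [hp, h t ht]
  have hp0 : p = 0 := (mul_eq_zero.1 hXp).resolve_left Polynomial.X_ne_zero
  intro k hk
  have := congrArg (fun q : Polynomial ℂ => q.coeff k) hp0
  simpa [p, Polynomial.finsetSum_coeff, Polynomial.coeff_monomial, hk] using this

/-- The homogeneous components of a polynomial vanishing on a punctured line vanish there. -/
theorem evalAt_homogeneousComponent_eq_zero {F : MvPolynomial (Module.Dual ℂ E) ℂ} {v : E}
    (h : ∀ t : ℂ, t ≠ 0 → evalAt F (t • v) = 0) (k : ℕ) :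
    evalAt (homogeneousComponent k F) v = 0 := by
  by_cases hk : F.totalDegree < k
  · rw [homogeneousComponent_eq_zero _ _ hk, evalAt, map_zero]
  refine eq_zero_of_sum_pow_mul_eq_zero (N := F.totalDegree + 1)
    (c := fun k => evalAt (homogeneousComponent k F) v) (fun t ht => ?_) k (by omega)
  rw [← h t ht]
  conv_rhs => rw [← sum_homogeneousComponent F]
  rw [evalAt, map_sum]
  exact Finset.sum_congr rfl fun j _ =>
    (evalAt_smul (homogeneousComponent_isHomogeneous j F) t v).symm

/-- Polynomials vanishing on the cone over a set vanish on the cone over its Zariski closure. -/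
theorem evalAt_eq_zero_of_mem_closure {A : Set (ℙ ℂ E)} {F : MvPolynomial (Module.Dual ℂ E) ℂ}
    (hF : ∀ (w : E) (hw : w ≠ 0), Projectivization.mk ℂ w hw ∈ A → evalAt F w = 0) {v : E}
    (hv : v ≠ 0) (hvA : Projectivization.mk ℂ v hv ∈ closure[zariskiTopology E] A) :
    evalAt F v = 0 := by
  rw [← sum_homogeneousComponent F, evalAt, map_sum]
  refine Finset.sum_eq_zero fun k _ => ?_
  have hk := homogeneousComponent_isHomogeneous k F
  refine (evalAt_rep_mk hk v hv).1 (evalAt_rep_eq_zero_of_mem_closure hvA hk fun q hq => ?_)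
  refine evalAt_homogeneousComponent_eq_zero (fun t ht => ?_) k
  refine hF _ (smul_ne_zero ht q.rep_nonzero) ?_
  have : Projectivization.mk ℂ (t • q.rep) (smul_ne_zero ht q.rep_nonzero) = q := by
    conv_rhs => rw [← q.mk_rep]
    rw [Projectivization.mk_eq_mk_iff']
    exact ⟨t, rfl⟩
  rwa [this]

/-- Sets with the same closure are met by the same homogeneous hypersurfaces. -/
theorem evalAt_eq_zero_of_closure_eq {A B : Set (ℙ ℂ E)}
    (hAB : closure[zariskiTopology E] A = closure[zariskiTopology E] B)
    {F : MvPolynomial (Module.Dual ℂ E) ℂ}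
    (hF : ∀ (w : E) (hw : w ≠ 0), Projectivization.mk ℂ w hw ∈ A → evalAt F w = 0) {v : E}
    (hv : v ≠ 0) (hvB : Projectivization.mk ℂ v hv ∈ B) : evalAt F v = 0 := by
  let _ := zariskiTopology E
  exact evalAt_eq_zero_of_mem_closure hF hv (hAB ▸ subset_closure hvB)

end Cone

/-! ### Equations of the Veronese variety -/

section Equations

/-- The coefficients of a form, divided by the multinomial coefficients. -/
def dividedCoeff (n d : ℕ) (α : Fin (n + 1) →₀ ℕ) : Module.Dual ℂ (Forms n d) :=
  (α.multinomial : ℂ)⁻¹ • (lcoeff ℂ α ∘ₗ (homogeneousSubmodule (Fin (n + 1)) ℂ d).subtype)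

theorem dividedCoeff_apply (α : Fin (n + 1) →₀ ℕ) (v : Forms n d) : dividedCoeff n d α v =
    (α.multinomial : ℂ)⁻¹ * coeff α (v : MvPolynomial (Fin (n + 1)) ℂ) := rfl

theorem multinomial_ne_zero (α : Fin (n + 1) →₀ ℕ) : (α.multinomial : ℂ) ≠ 0 :=
  Nat.cast_ne_zero.2 (Nat.multinomial_pos _ _).ne'

theorem dividedCoeff_linPow {α : Fin (n + 1) →₀ ℕ} (hα : α.degree = d) (a : Fin (n + 1) → ℂ) :
    dividedCoeff n d α (linPow n d a) = ∏ i, a i ^ α i := by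
  rw [dividedCoeff_apply, coeff_linPow a α hα, inv_mul_cancel_left₀ (multinomial_ne_zero α)]

theorem forms_ext {v w : Forms n d}
    (h : ∀ α : Fin (n + 1) →₀ ℕ, α.degree = d → dividedCoeff n d α v = dividedCoeff n d α w) :
    v = w := by
  apply Subtype.ext
  ext α
  by_cases hα : α.degree = d
  · exact mul_left_cancel₀ (inv_ne_zero (multinomial_ne_zero α)) (h α hα)
  · rw [IsHomogeneous.coeff_eq_zero v.2 hα, IsHomogeneous.coeff_eq_zero w.2 hα]

theorem dividedCoeff_single (i : Fin (n + 1)) (a : Fin (n + 1) → ℂ) :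
    dividedCoeff n d (Finsupp.single i d) (linPow n d a) = a i ^ d := by
  rw [dividedCoeff_linPow (by simp), Finset.prod_eq_single i]
  · simp
  · intro j _ hj
    simp [Finsupp.single_eq_of_ne hj]
  · simp

theorem dividedCoeff_single_add_single (hd : 1 ≤ d) (i j : Fin (n + 1)) (a : Fin (n + 1) → ℂ) :
    dividedCoeff n d (Finsupp.single i (d - 1) + Finsupp.single j 1) (linPow n d a) =
      a i ^ (d - 1) * a j := by
  classical
  rw [dividedCoeff_linPow (by rw [map_add, Finsupp.degree_single, Finsupp.degree_single,
    Nat.sub_add_cancel hd])]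
  simp only [Finsupp.add_apply, pow_add, Finset.prod_mul_distrib, Finsupp.single_apply]
  simp

/-- In divided coefficients the Veronese map is monomial, and two families of relations suffice. The
first (`h1`) makes some pure-power coordinate `c` nonzero; the second (`h2`) then recovers the
linear form from the coordinates at `(d - 1)eᵢ + eⱼ`, divided by `c`. -/
theorem isZariskiClosed_veronese (hd : 1 ≤ d) : IsZariskiClosed (veronese n d) := by
  refine ⟨{F | (∃ k, F.IsHomogeneous k) ∧ ∀ a, evalAt F (linPow n d a) = 0}, fun F hF => hF.1, ?_⟩
  ext p
  constructor
  · intro hp F hF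
    obtain ⟨a, ha, rfl⟩ := mem_veronese_iff.1 hp
    obtain ⟨⟨k, hk⟩, h⟩ := hF
    exact (evalAt_rep_mk hk _ _).2 (h a)
  intro hp
  let y := dividedCoeff n d
  have hdeg (α : Fin (n + 1) →₀ ℕ) : ∑ i, α i = α.degree := (Finsupp.degree_eq_sum α).symm
  have h1 (α : Fin (n + 1) →₀ ℕ) (hα : α.degree = d) :
      y α p.rep ^ d = ∏ i, y (Finsupp.single i d) p.rep ^ α i := by
    have := hp (X (y α) ^ d - ∏ i, X (y (Finsupp.single i d)) ^ α i) ⟨⟨d, ?_⟩, fun a => ?_⟩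
    · simpa [evalAt, sub_eq_zero] using this
    · refine IsHomogeneous.sub (isHomogeneous_X_pow _ _) ?_
      have := IsHomogeneous.prod Finset.univ
        (fun i => (X (y (Finsupp.single i d)) : MvPolynomial (Module.Dual ℂ (Forms n d)) ℂ) ^ α i)
        α fun i _ => isHomogeneous_X_pow _ _
      rwa [hdeg, hα] at this
    · have e : evalAt (X (y α) ^ d - ∏ i, X (y (Finsupp.single i d)) ^ α i) (linPow n d a) =
          y α (linPow n d a) ^ d - ∏ i, y (Finsupp.single i d) (linPow n d a) ^ α i := by
        simp [evalAt]
      rw [e, sub_eq_zero]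
      simp only [y, dividedCoeff_single, dividedCoeff_linPow hα, ← Finset.prod_pow]
      exact Finset.prod_congr rfl fun i _ => by rw [← pow_mul, ← pow_mul, mul_comm]
  have h2 (i) (α : Fin (n + 1) →₀ ℕ) (hα : α.degree = d) :
      y (Finsupp.single i d) p.rep ^ (d - 1) * y α p.rep =
        ∏ j, y (Finsupp.single i (d - 1) + Finsupp.single j 1) p.rep ^ α j := by
    have := hp (X (y (Finsupp.single i d)) ^ (d - 1) * X (y α) -
      ∏ j, X (y (Finsupp.single i (d - 1) + Finsupp.single j 1)) ^ α j) ⟨⟨d, ?_⟩, fun a => ?_⟩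
    · simpa [evalAt, sub_eq_zero] using this
    · refine IsHomogeneous.sub ?_ ?_
      · have := (isHomogeneous_X_pow (R := ℂ) (y (Finsupp.single i d)) (d - 1)).mul
          (isHomogeneous_X ℂ (y α))
        rwa [Nat.sub_add_cancel hd] at this
      have := IsHomogeneous.prod Finset.univ
        (fun j => (X (y (Finsupp.single i (d - 1) + Finsupp.single j 1)) :
          MvPolynomial (Module.Dual ℂ (Forms n d)) ℂ) ^ α j)
        α fun i _ => isHomogeneous_X_pow _ _
      rwa [hdeg, hα] at this
    · have e : evalAt (X (y (Finsupp.single i d)) ^ (d - 1) * X (y α) -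
          ∏ j, X (y (Finsupp.single i (d - 1) + Finsupp.single j 1)) ^ α j) (linPow n d a) =
          y (Finsupp.single i d) (linPow n d a) ^ (d - 1) * y α (linPow n d a) -
          ∏ j, y (Finsupp.single i (d - 1) + Finsupp.single j 1) (linPow n d a) ^ α j := by
        simp [evalAt]
      rw [e, sub_eq_zero]
      simp only [y, dividedCoeff_single, dividedCoeff_linPow hα,
        dividedCoeff_single_add_single hd, mul_pow, Finset.prod_mul_distrib,
        Finset.prod_pow_eq_pow_sum, hdeg, hα]
      rw [← pow_mul, ← pow_mul, mul_comm d]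
  obtain ⟨i, hi⟩ : ∃ i, y (Finsupp.single i d) p.rep ≠ 0 := by
    by_contra! H
    refine p.rep_nonzero (forms_ext fun α hα => ?_)
    rw [map_zero]
    have hα0 : α ≠ 0 := by
      rintro rfl
      simp at hα
      omega
    obtain ⟨i, hi⟩ := Finsupp.ne_iff.1 hα0
    have := h1 α hα
    rw [Finset.prod_eq_zero (Finset.mem_univ i) (by rw [H i]; exact zero_pow hi)] at this
    exact pow_eq_zero_iff (by omega) |>.1 this
  set c := y (Finsupp.single i d) p.rep with hc
  let b : Fin (n + 1) → ℂ :=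
    fun j => c⁻¹ * y (Finsupp.single i (d - 1) + Finsupp.single j 1) p.rep
  have hb : p.rep = c • linPow n d b := by
    refine forms_ext fun α hα => ?_
    rw [map_smul, dividedCoeff_linPow hα, smul_eq_mul]
    simp only [b, mul_pow, Finset.prod_mul_distrib, Finset.prod_pow_eq_pow_sum, hdeg, hα]
    rw [← h2 i α hα, ← hc]
    change y α p.rep = _
    obtain ⟨e, rfl⟩ : ∃ e, d = e + 1 := ⟨d - 1, by omega⟩
    rw [Nat.add_sub_cancel, inv_pow, pow_succ]
    field_simp
  have hb0 : b ≠ 0 := by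
    intro h
    rw [h, linPow_zero hd, smul_zero] at hb
    exact p.rep_nonzero hb
  refine mem_veronese_iff.2 ⟨b, hb0, ?_⟩
  conv_lhs => rw [← p.mk_rep]
  rw [Projectivization.mk_eq_mk_iff']
  exact ⟨c, hb.symm⟩

theorem eval_homogeneousComponent_eq_zero {q : MvPolynomial (Fin (n + 1)) ℂ}
    {a : Fin (n + 1) → ℂ} (h : ∀ t : ℂ, t ≠ 0 → eval (t • a) q = 0) (k : ℕ) :
    eval a (homogeneousComponent k q) = 0 := by
  let e : Fin (n + 1) → Module.Dual ℂ (Fin (n + 1) → ℂ) := fun i => LinearMap.proj i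
  have he (r : MvPolynomial (Fin (n + 1)) ℂ) (x : Fin (n + 1) → ℂ) :
      evalAt (rename e r) x = eval x r := by
    rw [evalAt, eval_rename]
    rfl
  have := evalAt_homogeneousComponent_eq_zero (F := rename e q) (v := a)
    (fun t ht => by rw [he, h t ht]) k
  rwa [← rename_homogeneousComponent, he] at this

/-- A property of powers of linear forms that holds generically and is invariant under scaling
holds on the Veronese variety off a proper closed subset. -/
theorem exists_isClosed_ssubset_veronese (hd : 1 ≤ d) {P : (Fin (n + 1) → ℂ) → Prop}
    (hP : Generically P) {B : Set (ℙ ℂ (Forms n d))} (hB : B ⊆ veronese n d)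
    (hPB : ∀ a (ha : a ≠ 0), P a → Projectivization.mk ℂ _ (linPow_ne_zero (d := d) ha) ∉ B) :
    ∃ Z : Set (ℙ ℂ (Forms n d)),
      IsClosed[zariskiTopology (Forms n d)] Z ∧ Z ⊂ veronese n d ∧ B ⊆ Z := by
  obtain ⟨q, hq0, hq⟩ := hP
  -- A homogeneous component is enough: where it is nonzero, `q` is nonzero at some rescaling, which
  -- is the same point.
  obtain ⟨k, hk⟩ : ∃ k, homogeneousComponent k q ≠ 0 := by
    by_contra! H
    apply hq0
    rw [← sum_homogeneousComponent q]
    exact Finset.sum_eq_zero fun k _ => H k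
  -- On the power of `a` these coordinates give `a 0 ^ (d - 1) • a`, recovering `a` up to scale when
  -- `a 0 ≠ 0`; the first factor of `G` puts `a 0 = 0` into `Z`.
  let y : Fin (n + 1) → Module.Dual ℂ (Forms n d) := fun j =>
    dividedCoeff n d (Finsupp.single 0 (d - 1) + Finsupp.single j 1)
  let G : MvPolynomial (Module.Dual ℂ (Forms n d)) ℂ :=
    X (dividedCoeff n d (Finsupp.single 0 d)) * rename y (homogeneousComponent k q)
  have hG : G.IsHomogeneous (1 + k) :=
    (isHomogeneous_X _ _).mul (homogeneousComponent_isHomogeneous k q).rename_isHomogeneous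
  have hGeval (a : Fin (n + 1) → ℂ) : evalAt G (linPow n d a) =
      a 0 ^ d * eval (a 0 ^ (d - 1) • a) (homogeneousComponent k q) := by
    simp only [G, evalAt, map_mul, eval_X, eval_rename, dividedCoeff_single]
    congr 2
    exact congrArg eval (funext fun j => dividedCoeff_single_add_single hd 0 j a)
  let _ := zariskiTopology (Forms n d)
  refine ⟨veronese n d ∩ zeroLocus {G}, ?_, ⟨Set.inter_subset_left, fun H => ?_⟩,
    fun p hp => ⟨hB hp, ?_⟩⟩
  · exact (isClosed_zariski_iff.2 (isZariskiClosed_veronese hd)).inter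
      (isClosed_zariski_iff.2 ⟨{G}, by rintro _ rfl; exact ⟨_, hG⟩, rfl⟩)
  · obtain ⟨b, hb⟩ := exists_eval_ne_zero (mul_ne_zero (X_ne_zero (0 : Fin (n + 1))) hk)
    rw [map_mul, eval_X] at hb
    have hb0 : b 0 ≠ 0 := left_ne_zero_of_mul hb
    -- Chosen so that the coordinates `y` of the power of `s • b` are exactly `b`.
    obtain ⟨s, hs⟩ := IsAlgClosed.exists_pow_nat_eq ((b 0 ^ (d - 1))⁻¹) hd
    have hs0 : s ≠ 0 := by
      rintro rfl
      rw [zero_pow (by omega)] at hs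
      exact inv_ne_zero (pow_ne_zero _ hb0) hs.symm
    have hsb : s • b ≠ 0 := fun h => mul_ne_zero hs0 hb0 (congrFun h 0)
    have hmem := (H (mem_veronese_iff.2 ⟨s • b, hsb, rfl⟩)).2 G rfl
    rw [evalAt_rep_mk hG, hGeval] at hmem
    have e : (s • b) 0 ^ (d - 1) • s • b = b := by
      rw [smul_smul, Pi.smul_apply, smul_eq_mul, mul_pow, mul_right_comm, ← pow_succ,
        Nat.sub_add_cancel hd, hs, inv_mul_cancel₀ (pow_ne_zero _ hb0), one_smul]
    rw [e] at hmem
    exact mul_ne_zero (pow_ne_zero _ (mul_ne_zero hs0 hb0)) (right_ne_zero_of_mul hb) hmem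
  · rintro _ rfl
    obtain ⟨a, ha, rfl⟩ := mem_veronese_iff.1 (hB hp)
    rw [evalAt_rep_mk hG, hGeval]
    by_contra hne
    have ha0 : a 0 ≠ 0 := by
      intro h0
      rw [h0, zero_pow (by omega), zero_mul] at hne
      exact hne rfl
    obtain ⟨t, ht, hqt⟩ : ∃ t : ℂ, t ≠ 0 ∧ eval (t • a 0 ^ (d - 1) • a) q ≠ 0 := by
      by_contra! H
      exact right_ne_zero_of_mul hne (eval_homogeneousComponent_eq_zero H k)
    rw [smul_smul] at hqt
    have htne : t * a 0 ^ (d - 1) ≠ 0 := mul_ne_zero ht (pow_ne_zero _ ha0)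
    refine hPB _ (smul_ne_zero htne ha) (hq _ hqt) ?_
    have : Projectivization.mk ℂ _ (linPow_ne_zero (d := d) (smul_ne_zero htne ha)) =
        Projectivization.mk ℂ _ (linPow_ne_zero (d := d) ha) := by
      rw [Projectivization.mk_eq_mk_iff']
      exact ⟨_, (linPow_smul _ a).symm⟩
    rwa [this]

end Equations

/-! ### The projective hypotheses in terms of polynomials, and the conclusion. -/

/-- A polynomial witnessing the generic rank. -/
theorem IsGenericRank.exists_evalAt_ne_zero (hd : 1 ≤ d) {g k : ℕ}
    (hg : IsGenericRank (veronese n d) g) (hk : g ≤ k) :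
    ∃ (F : MvPolynomial (Module.Dual ℂ (Forms n d)) ℂ) (w₀ : Forms n d), evalAt F w₀ ≠ 0 ∧
      ∀ w, evalAt F w ≠ 0 → w ∈ SumPow n d k := by
  obtain ⟨U, hU, ⟨p, hp⟩, hrank⟩ := hg
  obtain ⟨S, hS, hUS⟩ := show IsZariskiClosed Uᶜ from hU
  have hp' : p ∉ zeroLocus S := by
    rw [← hUS]
    exact fun h => h hp
  simp only [zeroLocus, Set.mem_ofPred_eq, not_forall] at hp'
  obtain ⟨F, hF, hFp⟩ := hp'
  refine ⟨F, p.rep, hFp, fun w hw => ?_⟩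
  -- The zero form gives no projective point, yet a constant `F` does not vanish there.
  by_cases hw0 : w = 0
  · rw [hw0]
    exact zero_mem_sumPow hd k
  obtain ⟨j, hj⟩ := hS F hF
  rw [← rank_veronese_le_iff hd hw0, hrank]
  · exact hk
  · by_contra h
    have : Projectivization.mk ℂ w hw0 ∈ zeroLocus S := hUS ▸ h
    exact hw ((evalAt_rep_mk hj w hw0).1 (this F hF))

/-- The polynomial form of the density of an orbit in a rank locus. -/
theorem vanishesOnOrbit_iff (hd : 1 ≤ d) {k : ℕ} {v : Forms n d} (hv : v ≠ 0)
    (hW : rankLocusClosure (veronese n d) (k + 1) =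
      closure[zariskiTopology (Forms n d)] (glOrbit n d (Projectivization.mk ℂ v hv)))
    (F : MvPolynomial (Module.Dual ℂ (Forms n d)) ℂ) :
    VanishesOnOrbit v F ↔ ∀ w ∈ SumPow n d (k + 1) \ SumPow n d k, evalAt F w = 0 := by
  constructor
  · intro hF w hw
    have hw0 : w ≠ 0 := by
      rintro rfl
      exact hw.2 (zero_mem_sumPow hd k)
    refine evalAt_eq_zero_of_closure_eq hW.symm (fun u hu ⟨g, hg⟩ => ?_) hw0
      ((rank_veronese_eq_succ_iff hd hw0).2 hw)
    simp only [Projectivization.map_mk] at hg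
    rw [Projectivization.mk_eq_mk_iff'] at hg
    obtain ⟨t, ht⟩ := hg
    have ht0 : t ≠ 0 := by
      rintro rfl
      rw [zero_smul] at ht
      exact hv (substForm_injective n d g (by rw [← ht, map_zero]))
    obtain ⟨h, hh⟩ := exists_smul_substForm hd (inv_ne_zero ht0) g v
    have : u = substForm n d h v := by rw [← hh, ← ht, inv_smul_smul₀ ht0]
    rw [this]
    exact hF h
  · intro hF g
    have hgv : substForm n d g v ≠ 0 := fun h =>
      hv (substForm_injective n d g (by rw [h, map_zero]))
    exact evalAt_eq_zero_of_closure_eq hW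
      (fun w hw hrank => hF w ((rank_veronese_eq_succ_iff hd hw).1 hrank)) hgv ⟨g, rfl⟩

end XRank

end

theorem mainTheorem12 (n d : ℕ) (hd : 1 ≤ d) (g m : ℕ)
    (hg : XRank.IsGenericRank (XRank.veronese n d) g) (hm : g < m)
    (f : ℙ ℂ (XRank.Forms n d))
    (hW : XRank.rankLocusClosure (XRank.veronese n d) m =
      closure[XRank.zariskiTopology (XRank.Forms n d)] (XRank.glOrbit n d f)) :
    ∃ Z : Set (ℙ ℂ (XRank.Forms n d)),
      IsClosed[XRank.zariskiTopology (XRank.Forms n d)] Z ∧ Z ⊂ XRank.veronese n d ∧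
        XRank.forbiddenLocus (XRank.veronese n d) f ⊆ Z := by
  obtain ⟨k, rfl⟩ : ∃ k, m = k + 1 := ⟨m - 1, by omega⟩
  induction f using Projectivization.ind with
  | h v hv =>
    have hI := XRank.vanishesOnOrbit_iff hd hv hW
    -- The rank of `f` is not given: it is `k + 1` because some translate of `v` has this rank and
    -- rank is GL-invariant.
    obtain ⟨h, hmem⟩ := XRank.exists_substForm_mem hd hI
    rw [Set.mem_sdiff, XRank.substForm_mem_sumPow_iff, XRank.substForm_mem_sumPow_iff] at hmem
    have hrank := (XRank.rank_veronese_eq_succ_iff hd hv).2 hmem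
    obtain ⟨F₀, w₀, hw₀, hF₀⟩ := hg.exists_evalAt_ne_zero hd (Nat.le_of_lt_succ hm)
    exact XRank.exists_isClosed_ssubset_veronese hd
      (XRank.generically_add_linPow_mem_sumPow hd hI hw₀ hF₀) (fun p hp => hp.1)
      fun a ha h => XRank.notMem_forbiddenLocus hd hv hrank ha h
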